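/- Let $G$ be a group with identity $e$, and let $(A_p)_{p\in G}$ be a family of finite-dimensional unital algebras over $\mathbb{C}$. Suppose we are given unital algebra homomorphisms $\Delta_{p,q}:A_{pq}\to A_p\otimes A_q$ $(p,q\in G)$, a unital algebra homomorphism $\varepsilon:A_e\to\mathbb{C}$, and linear maps $S_p:A_p\to A_{p^{-1}}$ $(p\in G)$. Call these data a Hopf $G$-coalgebra in the sense of Virelizier if, with $\iota$ denoting identity maps and $m$ the multiplication of $A_p$, for all $p,q,r\in G$: (i) $(\Delta_{p,q}\otimes\iota)\Delta_{pq,r}=(\iota\otimes\Delta_{q,r})\Delta_{p,qr}$ on $A_{pqr}$; (ii) $(\iota\otimes\varepsilon)\Delta_{p,e}(a)=a=(\varepsilon\otimes\iota)\Delta_{e,p}(a)$ for all $a\in A_p$; (iii) $m(S_{p^{-1}}\otimes\iota)\Delta_{p^{-1},p}(a)=\varepsilon(a)1=m(\iota\otimes S_{p^{-1}})\Delta_{p,p^{-1}}(a)$ in $A_p$ for all $a\in A_e$. Call them a Hopf $G$-coalgebra in the sense of Turaev if moreover every $S_p$ is an algebra anti-isomorphism, that is, a bijective linear map with $S_p(1)=1$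 and $S_p(ab)=S_p(b)S_p(a)$ for all $a,b\in A_p$. If the data form a Hopf $G$-coalgebra in the sense of Virelizier, then $S_p:A_p\to A_{p^{-1}}$ is an algebra anti-isomorphism for every $p\in G$. Consequently, for such finite-dimensional data, being a Hopf $G$-coalgebra in the sense of Virelizier and being one in the sense of Turaev are equivalent. -/

import Mathlib

open scoped TensorProduct

universe u v

/-- The data underlying a Hopf `G`-coalgebra on a family `(A p)` of unital complex algebras:
unital homomorphisms `Δ_{p,q} : A_{pq} → A_p ⊗ A_q`, a unital homomorphism `ε : A_e → ℂ`,
and linear maps `S_p : A_p → A_{p⁻¹}`. No axiom is imposed here. -/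
structure HopfGroupData (G : Type u) [Group G] (A : G → Type v)
    [∀ p, Ring (A p)] [∀ p, Algebra ℂ (A p)] where
  comul : ∀ p q : G, A (p * q) →ₐ[ℂ] A p ⊗[ℂ] A q
  counit : A 1 →ₐ[ℂ] ℂ
  antipode : ∀ p : G, A p →ₗ[ℂ] A p⁻¹

/-- A linear map between unital complex algebras is an algebra anti-isomorphism: it is an
isomorphism of unital algebras onto the opposite of the target. -/
def IsAlgAntiIso {B : Type*} {C : Type*} [Ring B] [Algebra ℂ B] [Ring C] [Algebra ℂ C]
    (f : B →ₗ[ℂ] C) : Prop :=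
  ∃ φ : B ≃ₐ[ℂ] Cᵐᵒᵖ, ∀ b : B, φ b = MulOpposite.op (f b)

namespace HopfGroupData

variable {G : Type u} [Group G] {A : G → Type v} [∀ p, Ring (A p)] [∀ p, Algebra ℂ (A p)]

/-- `(Δ_{p,q} ⊗ ι) Δ_{pq,r} = (ι ⊗ Δ_{q,r}) Δ_{p,qr}` on `A_{pqr}`. Here and below,
`AlgEquiv.cast` is the identity map `A p → A q` for equal group elements `p = q`. -/
def Coassociative (H : HopfGroupData G A) : Prop :=
  ∀ (p q r : G) (a : A (p * q * r)),
    TensorProduct.assoc ℂ (A p) (A q) (A r)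
        ((H.comul p q).toLinearMap.rTensor (A r) (H.comul (p * q) r a)) =
      (H.comul q r).toLinearMap.lTensor (A p)
        (H.comul p (q * r) (AlgEquiv.cast (R := ℂ) (A := A) (mul_assoc p q r) a))

/-- `(ι ⊗ ε) Δ_{p,e}(a) = a = (ε ⊗ ι) Δ_{e,p}(a)` for `a ∈ A_p`. -/
def Counital (H : HopfGroupData G A) : Prop :=
  ∀ (p : G) (a : A p),
    TensorProduct.rid ℂ (A p)
        (H.counit.toLinearMap.lTensor (A p) (H.comul p 1 (AlgEquiv.cast (R := ℂ) (A := A) (mul_one p).symm a))) = a ∧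
      TensorProduct.lid ℂ (A p)
        (H.counit.toLinearMap.rTensor (A p) (H.comul 1 p (AlgEquiv.cast (R := ℂ) (A := A) (one_mul p).symm a))) = a

/-- The map `S_{p⁻¹}`, regarded as a map from `A_{p⁻¹}` to `A_p`. -/
def antipodeInv (H : HopfGroupData G A) (p : G) : A p⁻¹ →ₗ[ℂ] A p :=
  (AlgEquiv.cast (R := ℂ) (A := A) (inv_inv p)).toLinearMap ∘ₗ H.antipode p⁻¹

/-- `m (S_{p⁻¹} ⊗ ι) Δ_{p⁻¹,p}(a) = ε(a) 1 = m (ι ⊗ S_{p⁻¹}) Δ_{p,p⁻¹}(a)` in `A_p`,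
for `a ∈ A_e`. -/
def Antipodal (H : HopfGroupData G A) : Prop :=
  ∀ (p : G) (a : A 1),
    LinearMap.mul' ℂ (A p)
        ((H.antipodeInv p).rTensor (A p)
          (H.comul p⁻¹ p (AlgEquiv.cast (R := ℂ) (A := A) (inv_mul_cancel p).symm a))) = H.counit a • (1 : A p) ∧
      LinearMap.mul' ℂ (A p)
        ((H.antipodeInv p).lTensor (A p)
          (H.comul p p⁻¹ (AlgEquiv.cast (R := ℂ) (A := A) (mul_inv_cancel p).symm a))) = H.counit a • (1 : A p)

/-- Hopf `G`-coalgebra in the sense of Virelizier: the maps `S_p` are only required to be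
linear. -/
structure IsVirelizier (H : HopfGroupData G A) : Prop where
  coassociative : H.Coassociative
  counital : H.Counital
  antipodal : H.Antipodal

/-- Hopf `G`-coalgebra in the sense of Turaev: the maps `S_p` are moreover required to be
algebra anti-isomorphisms. -/
structure IsTuraev (H : HopfGroupData G A) : Prop where
  coassociative : H.Coassociative
  counital : H.Counital
  antipodal : H.Antipodal
  antipode_antiIso : ∀ p : G, IsAlgAntiIso (H.antipode p)

end HopfGroupData

/-! Linear maps out of the `A p` multiply by convolution, with unit `a ↦ ε(a) 1`, and a left inverse
agrees with a right inverse (`eq_of_conv_eq_convOne`). The antipode axiom says that `S` is a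
two-sided inverse of the identity. Comparing inverses of the multiplication on the tensor square
shows that `S` reverses products; comparing inverses of `Δ` on `A 1` shows that it reverses `Δ`
there. So `T = S²` is an algebra endomorphism compatible with `ε` and with `Δ` on `A 1`.

Bijectivity uses finite dimension through Fitting's decomposition: for large `N`, let `P` project
onto the image of `T ^ N` along its kernel. These projections are again compatible with `Δ` on `A 1`
and with `ε`. If `φ` is an algebra homomorphism with `φ S P = φ S`, then `φ` and `φ P` are both
convolution inverses of `φ S`, so `φ P = φ`. Starting from `T ^ N P = T ^ N` and cancelling one
antipode at a time gives `P = 1`. Hence `T`, and then `S`, is bijective. -/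

/-- A family of complex vector spaces indexed by a group, with coassociative comultiplications
`C_{pq} → C_p ⊗ C_q` and a counit on `C_1`. The comultiplications are indexed by proofs of
`p * q = r`, so that no transport between equal indices is needed. -/
structure GroupCoalgebra (G : Type u) [Group G] (C : G → Type v)
    [∀ p, AddCommGroup (C p)] [∀ p, Module ℂ (C p)] where
  comul : ∀ {p q r : G}, p * q = r → C r →ₗ[ℂ] C p ⊗[ℂ] C q
  counit : C 1 →ₗ[ℂ] ℂ
  coassoc : ∀ {p q r s t u : G} (hpq : p * q = s) (hs : s * r = u) (hqr : q * r = t)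
    (ht : p * t = u) (a : C u),
    TensorProduct.assoc ℂ (C p) (C q) (C r) ((comul hpq).rTensor (C r) (comul hs a)) =
      (comul hqr).lTensor (C p) (comul ht a)
  lTensor_counit : ∀ {p : G} (h : p * 1 = p) (a : C p),
    counit.lTensor (C p) (comul h a) = a ⊗ₜ 1
  rTensor_counit : ∀ {p : G} (h : 1 * p = p) (a : C p),
    counit.rTensor (C p) (comul h a) = 1 ⊗ₜ a

namespace GroupCoalgebra

/-! ### Convolution of linear maps -/

section Convolution

variable {G : Type u} [Group G] {C : G → Type v}
  [∀ p, AddCommGroup (C p)] [∀ p, Module ℂ (C p)] (K : GroupCoalgebra G C)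
  {D : Type*} [Ring D] [Algebra ℂ D] {D' : Type*} [Ring D'] [Algebra ℂ D']

/-- The convolution product of `f : C_p → D` and `g : C_q → D`. -/
def conv {p q r : G} (h : p * q = r) (f : C p →ₗ[ℂ] D) (g : C q →ₗ[ℂ] D) : C r →ₗ[ℂ] D :=
  LinearMap.mul' ℂ D ∘ₗ TensorProduct.map f g ∘ₗ K.comul h

/-- The unit `a ↦ ε(a) 1` of the convolution product. -/
def convOne (D : Type*) [Ring D] [Algebra ℂ D] : C 1 →ₗ[ℂ] D :=
  K.counit.smulRight 1

theorem conv_assoc {p q r s t u : G} (hpq : p * q = s) (hs : s * r = u) (hqr : q * r = t)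
    (ht : p * t = u) (f : C p →ₗ[ℂ] D) (g : C q →ₗ[ℂ] D) (k : C r →ₗ[ℂ] D) :
    K.conv hs (K.conv hpq f g) k = K.conv ht f (K.conv hqr g k) := by
  let M : C p ⊗[ℂ] (C q ⊗[ℂ] C r) →ₗ[ℂ] D :=
    LinearMap.mul' ℂ D ∘ₗ TensorProduct.map f (LinearMap.mul' ℂ D ∘ₗ TensorProduct.map g k)
  have h₁ : ∀ x : C s ⊗[ℂ] C r, LinearMap.mul' ℂ D (TensorProduct.map (K.conv hpq f g) k x) =
      M (TensorProduct.assoc ℂ (C p) (C q) (C r) ((K.comul hpq).rTensor (C r) x)) := by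
    intro x
    induction x with
    | zero => simp
    | add x y hx hy => simp only [map_add, hx, hy]
    | tmul x z =>
      simp only [TensorProduct.map_tmul, conv, LinearMap.comp_apply, LinearMap.rTensor_tmul]
      generalize K.comul hpq x = y
      induction y with
      | zero => simp
      | add x y hx hy => simp only [map_add, TensorProduct.add_tmul, hx, hy]
      | tmul x y => simp [M, mul_assoc]
  have h₂ : ∀ x : C p ⊗[ℂ] C t, LinearMap.mul' ℂ D (TensorProduct.map f (K.conv hqr g k) x) =
      M ((K.comul hqr).lTensor (C p) x) := by
    intro x
    induction x with
    | zero => simp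
    | add x y hx hy => simp only [map_add, hx, hy]
    | tmul x y => simp [M, conv]
  ext a
  exact (h₁ _).trans ((congrArg M (K.coassoc hpq hs hqr ht a)).trans (h₂ _).symm)

theorem conv_convOne {p : G} (h : p * 1 = p) (f : C p →ₗ[ℂ] D) :
    K.conv h f (K.convOne D) = f := by
  have h₁ : TensorProduct.map f (K.convOne D) =
      TensorProduct.map f ((LinearMap.toSpanSingleton ℂ D 1)) ∘ₗ K.counit.lTensor (C p) := by
    ext x y
    simp [convOne]
  ext a
  simp only [conv, h₁, LinearMap.comp_apply, K.lTensor_counit]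
  simp

theorem convOne_conv {p : G} (h : 1 * p = p) (f : C p →ₗ[ℂ] D) :
    K.conv h (K.convOne D) f = f := by
  have h₁ : TensorProduct.map (K.convOne D) f =
      TensorProduct.map ((LinearMap.toSpanSingleton ℂ D 1)) f ∘ₗ K.counit.rTensor (C p) := by
    ext x y
    simp [convOne]
  ext a
  simp only [conv, h₁, LinearMap.comp_apply, K.rTensor_counit]
  simp

/-- A left and a right convolution inverse of the same map agree. -/
theorem eq_of_conv_eq_convOne {p q : G} (hpq : p * q = 1) (hqp : q * p = 1)
    {f f' : C p →ₗ[ℂ] D} {g : C q →ₗ[ℂ] D} (h : K.conv hpq f g = K.convOne D)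
    (h' : K.conv hqp g f' = K.convOne D) : f = f' := by
  rw [← K.conv_convOne (mul_one p) f, ← h',
    ← K.conv_assoc hpq (one_mul p) hqp (mul_one p), h, K.convOne_conv]

theorem comp_conv {p q r : G} (h : p * q = r) (φ : D →ₐ[ℂ] D') (f : C p →ₗ[ℂ] D)
    (g : C q →ₗ[ℂ] D) :
    φ.toLinearMap ∘ₗ K.conv h f g =
      K.conv h (φ.toLinearMap ∘ₗ f) (φ.toLinearMap ∘ₗ g) := by
  have h₁ : φ.toLinearMap ∘ₗ LinearMap.mul' ℂ D ∘ₗ TensorProduct.map f g =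
      LinearMap.mul' ℂ D' ∘ₗ
        TensorProduct.map (φ.toLinearMap ∘ₗ f) (φ.toLinearMap ∘ₗ g) := by
    ext x y
    simp
  simp only [conv, ← LinearMap.comp_assoc] at h₁ ⊢
  rw [h₁]

theorem comp_convOne (φ : D →ₐ[ℂ] D') :
    φ.toLinearMap ∘ₗ K.convOne D = K.convOne D' := by
  ext a
  simp [convOne]

end Convolution

/-! ### The tensor square of a group coalgebra -/

section Tensor

variable {G : Type u} [Group G] {C : G → Type v}
  [∀ p, AddCommGroup (C p)] [∀ p, Module ℂ (C p)] (K : GroupCoalgebra G C)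

/-- The comultiplication of the tensor square of a group coalgebra. -/
noncomputable def tensorSquareComul {p q r : G} (h : p * q = r) :
    C r ⊗[ℂ] C r →ₗ[ℂ] (C p ⊗[ℂ] C p) ⊗[ℂ] (C q ⊗[ℂ] C q) :=
  (TensorProduct.tensorTensorTensorComm ℂ (C p) (C q) (C p) (C q)).toLinearMap ∘ₗ
    TensorProduct.map (K.comul h) (K.comul h)

theorem tensorSquareComul_tmul {p q r : G} (h : p * q = r) (a b : C r) :
    K.tensorSquareComul h (a ⊗ₜ b) =
      TensorProduct.tensorTensorTensorComm ℂ (C p) (C q) (C p) (C q)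
        (K.comul h a ⊗ₜ K.comul h b) := rfl

/-- The counit of the tensor square of a group coalgebra. -/
noncomputable def tensorSquareCounit : C 1 ⊗[ℂ] C 1 →ₗ[ℂ] ℂ :=
  LinearMap.mul' ℂ ℂ ∘ₗ TensorProduct.map K.counit K.counit

/-- The tensor square of a group coalgebra. -/
noncomputable def tensorSquare : GroupCoalgebra G (fun p => C p ⊗[ℂ] C p) where
  comul h := K.tensorSquareComul h
  counit := K.tensorSquareCounit
  coassoc {p q r s t u} hpq hs hqr ht a := by
    -- `M` shuffles two triple tensors together, so coassociativity reduces to that of each factor.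
    let M : (C p ⊗[ℂ] (C q ⊗[ℂ] C r)) ⊗[ℂ] (C p ⊗[ℂ] (C q ⊗[ℂ] C r)) →ₗ[ℂ]
        (C p ⊗[ℂ] C p) ⊗[ℂ] ((C q ⊗[ℂ] C q) ⊗[ℂ] (C r ⊗[ℂ] C r)) :=
      (TensorProduct.tensorTensorTensorComm ℂ (C q) (C r) (C q) (C r)).toLinearMap.lTensor _ ∘ₗ
        (TensorProduct.tensorTensorTensorComm ℂ (C p) (C q ⊗[ℂ] C r) (C p)
          (C q ⊗[ℂ] C r)).toLinearMap
    have hl : ∀ x y : C s ⊗[ℂ] C r,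
        TensorProduct.assoc ℂ _ _ _ ((K.tensorSquareComul hpq).rTensor _
          (TensorProduct.tensorTensorTensorComm ℂ _ _ _ _ (x ⊗ₜ[ℂ] y))) =
        M (TensorProduct.assoc ℂ _ _ _ ((K.comul hpq).rTensor _ x) ⊗ₜ
          TensorProduct.assoc ℂ _ _ _ ((K.comul hpq).rTensor _ y)) := by
      intro x y
      induction x with
      | zero => simp
      | add x x' hx hx' => simp only [TensorProduct.add_tmul, map_add, hx, hx']
      | tmul x₁ x₂ =>
        induction y with
        | zero => simp
        | add y y' hy hy' => simp only [TensorProduct.tmul_add, map_add, hy, hy']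
        | tmul y₁ y₂ =>
          simp only [TensorProduct.tensorTensorTensorComm_tmul, LinearMap.rTensor_tmul,
            tensorSquareComul_tmul]
          generalize K.comul hpq x₁ = x
          generalize K.comul hpq y₁ = y
          induction x with
          | zero => simp
          | add x x' hx hx' => simp only [TensorProduct.add_tmul, map_add, hx, hx']
          | tmul x₁ x₂ =>
            induction y with
            | zero => simp
            | add y y' hy hy' =>
              simp only [TensorProduct.add_tmul, TensorProduct.tmul_add, map_add, hy, hy']
            | tmul y₁ y₂ => simp [M]
    have hr : ∀ x y : C p ⊗[ℂ] C t,
        (K.tensorSquareComul hqr).lTensor _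
          (TensorProduct.tensorTensorTensorComm ℂ _ _ _ _ (x ⊗ₜ[ℂ] y)) =
        M ((K.comul hqr).lTensor _ x ⊗ₜ (K.comul hqr).lTensor _ y) := by
      intro x y
      induction x with
      | zero => simp
      | add x x' hx hx' => simp only [TensorProduct.add_tmul, map_add, hx, hx']
      | tmul x₁ x₂ =>
        induction y with
        | zero => simp
        | add y y' hy hy' => simp only [TensorProduct.tmul_add, map_add, hy, hy']
        | tmul y₁ y₂ => simp [M, tensorSquareComul_tmul]
    induction a with
    | zero => simp
    | add a b ha hb => simp only [map_add, ha, hb]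
    | tmul a b =>
      rw [tensorSquareComul_tmul, tensorSquareComul_tmul, hl, hr, K.coassoc hpq hs hqr ht,
        K.coassoc hpq hs hqr ht]
  lTensor_counit {p} h a := by
    have key : ∀ x y : C p ⊗[ℂ] C 1,
        K.tensorSquareCounit.lTensor _
          (TensorProduct.tensorTensorTensorComm ℂ _ _ _ _ (x ⊗ₜ[ℂ] y)) =
        (LinearMap.mul' ℂ ℂ).lTensor _ (TensorProduct.tensorTensorTensorComm ℂ _ _ _ _
          (K.counit.lTensor _ x ⊗ₜ[ℂ] K.counit.lTensor _ y)) := by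
      intro x y
      induction x with
      | zero => simp
      | add x x' hx hx' => simp only [TensorProduct.add_tmul, map_add, hx, hx']
      | tmul x₁ x₂ =>
        induction y with
        | zero => simp
        | add y y' hy hy' => simp only [TensorProduct.tmul_add, map_add, hy, hy']
        | tmul y₁ y₂ => simp [tensorSquareCounit]
    induction a with
    | zero => simp
    | add a b ha hb => simp only [map_add, ha, hb, TensorProduct.add_tmul]
    | tmul a b =>
      rw [tensorSquareComul_tmul, key, K.lTensor_counit, K.lTensor_counit]
      simp
  rTensor_counit {p} h a := by
    have key : ∀ x y : C 1 ⊗[ℂ] C p,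
        K.tensorSquareCounit.rTensor _
          (TensorProduct.tensorTensorTensorComm ℂ _ _ _ _ (x ⊗ₜ[ℂ] y)) =
        (LinearMap.mul' ℂ ℂ).rTensor _ (TensorProduct.tensorTensorTensorComm ℂ _ _ _ _
          (K.counit.rTensor _ x ⊗ₜ[ℂ] K.counit.rTensor _ y)) := by
      intro x y
      induction x with
      | zero => simp
      | add x x' hx hx' => simp only [TensorProduct.add_tmul, map_add, hx, hx']
      | tmul x₁ x₂ =>
        induction y with
        | zero => simp
        | add y y' hy hy' => simp only [TensorProduct.tmul_add, map_add, hy, hy']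
        | tmul y₁ y₂ => simp [tensorSquareCounit]
    induction a with
    | zero => simp
    | add a b ha hb => simp only [map_add, ha, hb, TensorProduct.tmul_add]
    | tmul a b =>
      rw [tensorSquareComul_tmul, key, K.rTensor_counit, K.rTensor_counit]
      simp

end Tensor

end GroupCoalgebra

/-! ### Fitting projections -/

/-- Every large power of an endomorphism of a finite-dimensional space has a generalized inverse
that commutes with the endomorphism. -/
theorem Module.End.exists_forall_pow_mul_mul_pow_eq {F V : Type*} [Field F] [AddCommGroup V]
    [Module F V] [FiniteDimensional F V] (T : Module.End F V) :
    ∃ k : ℕ, ∀ N, k ≤ N → ∃ U : Module.End F V, Commute T U ∧ T ^ N * U * T ^ N = T ^ N := by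
  have hm : minpoly F T ≠ 0 := minpoly.ne_zero (Algebra.IsIntegral.isIntegral T)
  obtain ⟨g, hg, hXg⟩ := Polynomial.exists_eq_pow_rootMultiplicity_mul_and_not_dvd
    (minpoly F T) hm 0
  rw [map_zero, sub_zero] at hg hXg
  refine ⟨(minpoly F T).rootMultiplicity 0, fun N hN => ?_⟩
  -- With `minpoly = X ^ k * g`, Bézout gives `w X ^ N + v g = 1`; so `w(T)` inverts `T ^ N` up to
  -- the factor `v g`, which `X ^ N` turns into a multiple of `minpoly`.
  obtain ⟨w, v, hwv⟩ : IsCoprime (Polynomial.X ^ N : Polynomial F) g :=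
    ((Polynomial.irreducible_X.coprime_iff_not_dvd).2 hXg).pow_left
  refine ⟨Polynomial.aeval T w, ?_, ?_⟩
  · simpa using (Polynomial.commute_X w).map (Polynomial.aeval T)
  · obtain ⟨d, rfl⟩ := Nat.exists_eq_add_of_le hN
    set k := (minpoly F T).rootMultiplicity 0
    have h₁ : (Polynomial.X ^ (k + d) - Polynomial.X ^ (k + d) * w * Polynomial.X ^ (k + d) :
        Polynomial F) = minpoly F T * (Polynomial.X ^ d * v) := by
      rw [hg]
      linear_combination (-Polynomial.X ^ (k + d) : Polynomial F) * hwv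
    have h₂ := congrArg (Polynomial.aeval T) h₁
    simp only [map_sub, map_mul, map_pow, Polynomial.aeval_X, minpoly.aeval, zero_mul] at h₂
    exact (sub_eq_zero.1 h₂).symm

/-- If `δ` intertwines `T₁` with `T ⊗ T'`, then it intertwines the idempotents obtained from
generalized inverses. -/
theorem map_comp_eq_comp_of_mul_mul_eq {F V V' W : Type*} [Field F] [AddCommGroup V]
    [Module F V] [AddCommGroup V'] [Module F V'] [AddCommGroup W] [Module F W]
    {δ : W →ₗ[F] V ⊗[F] V'} {T U : Module.End F V} {T' U' : Module.End F V'}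
    {T₁ U₁ : Module.End F W} (hδ : δ ∘ₗ T₁ = TensorProduct.map T T' ∘ₗ δ)
    (hTU : T * U = U * T) (hTU' : T' * U' = U' * T')
    (hU : T * U * T = T) (hU' : T' * U' * T' = T')
    (hTU₁ : T₁ * U₁ = U₁ * T₁) (hU₁ : T₁ * U₁ * T₁ = T₁) :
    TensorProduct.map (T * U) (T' * U') ∘ₗ δ = δ ∘ₗ (T₁ * U₁) := by
  -- The tensor idempotent fixes `δ(im T₁)` by `h₁` and kills `δ(ker T₁)` by `h₂`.
  have h₁ : TensorProduct.map (T * U) (T' * U') ∘ₗ δ ∘ₗ T₁ = δ ∘ₗ T₁ := by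
    rw [hδ, ← LinearMap.comp_assoc, ← TensorProduct.map_comp, ← Module.End.mul_eq_comp,
      ← Module.End.mul_eq_comp, hU, hU']
  have h₂ : TensorProduct.map (T * U) (T' * U') ∘ₗ δ =
      TensorProduct.map U U' ∘ₗ δ ∘ₗ T₁ := by
    rw [hδ, ← LinearMap.comp_assoc, ← TensorProduct.map_comp, ← Module.End.mul_eq_comp,
      ← Module.End.mul_eq_comp, hTU, hTU']
  calc TensorProduct.map (T * U) (T' * U') ∘ₗ δ
      = (TensorProduct.map U U' ∘ₗ δ ∘ₗ T₁) ∘ₗ (U₁ * T₁) := by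
        rw [h₂]
        conv_lhs => rw [← hU₁]
        rfl
    _ = (TensorProduct.map (T * U) (T' * U') ∘ₗ δ ∘ₗ T₁) ∘ₗ U₁ := by
        rw [← h₂, ← hTU₁]
        rfl
    _ = δ ∘ₗ (T₁ * U₁) := by rw [h₁]; rfl

/-! ### The antipode as an algebra anti-homomorphism -/

namespace HopfGroupData

variable {G : Type u} [Group G] {A : G → Type v} [∀ p, Ring (A p)] [∀ p, Algebra ℂ (A p)]

/-- The comultiplication `Δ_{p,q}`, as a map on `A_r` for `p q = r`. -/
noncomputable def comulOf (H : HopfGroupData G A) {p q r : G} (h : p * q = r) :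
    A r →ₐ[ℂ] A p ⊗[ℂ] A q :=
  (H.comul p q).comp (AlgEquiv.cast (R := ℂ) (A := A) h.symm).toAlgHom

/-- The antipode `S_p`, as a map from `A_p` to `A_q` for `p q = 1`. -/
noncomputable def antipodeOf (H : HopfGroupData G A) {p q : G} (h : p * q = 1) :
    A p →ₗ[ℂ] A q :=
  (AlgEquiv.cast (R := ℂ) (A := A) (inv_eq_of_mul_eq_one_right h)).toLinearMap ∘ₗ H.antipode p

namespace IsVirelizier

variable {H : HopfGroupData G A} (hH : H.IsVirelizier)

include hH

/-- The group coalgebra underlying a Hopf group coalgebra. -/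
noncomputable def toGroupCoalgebra : GroupCoalgebra G A where
  comul h := (H.comulOf h).toLinearMap
  counit := H.counit.toLinearMap
  coassoc {p q r s t u} hpq hs hqr ht a := by
    subst hpq hs hqr
    exact hH.coassociative p q r a
  lTensor_counit {p} h a := by
    apply (TensorProduct.rid ℂ (A p)).injective
    rw [TensorProduct.rid_tmul, one_smul]
    exact (hH.counital p a).1
  rTensor_counit {p} h a := by
    apply (TensorProduct.lid ℂ (A p)).injective
    rw [TensorProduct.lid_tmul, one_smul]
    exact (hH.counital p a).2

theorem conv_antipodeOf_id {p q : G} (hqp : q * p = 1) :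
    hH.toGroupCoalgebra.conv hqp (H.antipodeOf hqp) LinearMap.id =
      hH.toGroupCoalgebra.convOne (A p) := by
  obtain rfl : q = p⁻¹ := eq_inv_of_mul_eq_one_left hqp
  ext a
  exact (hH.antipodal p a).1

theorem conv_id_antipodeOf {p q : G} (hpq : p * q = 1) (hqp : q * p = 1) :
    hH.toGroupCoalgebra.conv hpq LinearMap.id (H.antipodeOf hqp) =
      hH.toGroupCoalgebra.convOne (A p) := by
  obtain rfl : q = p⁻¹ := eq_inv_of_mul_eq_one_left hqp
  ext a
  exact (hH.antipodal p a).2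

theorem antipodeOf_one {p q : G} (h : p * q = 1) : H.antipodeOf h 1 = 1 := by
  have h₁ := LinearMap.congr_fun (hH.conv_antipodeOf_id h) 1
  simpa [GroupCoalgebra.conv, GroupCoalgebra.convOne, toGroupCoalgebra,
    Algebra.TensorProduct.one_def] using h₁

/-- Both sides, as maps on the tensor square, are convolution inverses of the multiplication of `A
q`: `f` on the left, `f'` on the right. -/
theorem antipodeOf_mul {p q : G} (hpq : p * q = 1) (hqp : q * p = 1) (a b : A p) :
    H.antipodeOf hpq (a * b) = H.antipodeOf hpq b * H.antipodeOf hpq a := by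
  let K := hH.toGroupCoalgebra
  let S := H.antipodeOf hpq
  let f : A p ⊗[ℂ] A p →ₗ[ℂ] A q := S ∘ₗ LinearMap.mul' ℂ (A p)
  let f' : A p ⊗[ℂ] A p →ₗ[ℂ] A q := LinearMap.mul' ℂ (A q) ∘ₗ TensorProduct.map S S ∘ₗ
    (TensorProduct.comm ℂ (A p) (A p)).toLinearMap
  have hl : K.tensorSquare.conv hpq f (LinearMap.mul' ℂ (A q)) =
      K.tensorSquare.convOne (A q) := by
    have key : ∀ x y : A p ⊗[ℂ] A q, LinearMap.mul' ℂ (A q)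
        (TensorProduct.map f (LinearMap.mul' ℂ (A q))
          (TensorProduct.tensorTensorTensorComm ℂ _ _ _ _ (x ⊗ₜ[ℂ] y))) =
        LinearMap.mul' ℂ (A q) (TensorProduct.map S LinearMap.id (x * y)) := by
      intro x y
      induction x with
      | zero => simp
      | add x x' hx hx' => simp only [TensorProduct.add_tmul, map_add, hx, hx', add_mul]
      | tmul x₁ x₂ =>
        induction y with
        | zero => simp
        | add y y' hy hy' => simp only [TensorProduct.tmul_add, map_add, hy, hy', mul_add]
        | tmul y₁ y₂ => simp [f]
    ext a b
    refine (key (H.comulOf hpq a) (H.comulOf hpq b)).trans ?_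
    rw [← map_mul]
    refine (LinearMap.congr_fun (hH.conv_antipodeOf_id hpq) (a * b)).trans ?_
    simp [GroupCoalgebra.convOne, GroupCoalgebra.tensorSquare, toGroupCoalgebra, K,
      GroupCoalgebra.tensorSquareCounit]
  have hr : K.tensorSquare.conv hqp (LinearMap.mul' ℂ (A q)) f' =
      K.tensorSquare.convOne (A q) := by
    -- Only `b` needs to be comultiplied first: its two legs meet in the middle of `x₁ * _ * S x₂`
    -- and collapse to `ε(b)`.
    have key : ∀ (x : A q ⊗[ℂ] A p) (b : A 1), LinearMap.mul' ℂ (A q)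
        (TensorProduct.map (LinearMap.mul' ℂ (A q)) f'
          (TensorProduct.tensorTensorTensorComm ℂ _ _ _ _ (x ⊗ₜ[ℂ] H.comulOf hqp b))) =
        H.counit b • LinearMap.mul' ℂ (A q) (TensorProduct.map LinearMap.id S x) := by
      intro x b
      induction x with
      | zero => simp
      | add x x' hx hx' => simp only [TensorProduct.add_tmul, map_add, hx, hx', smul_add]
      | tmul x₁ x₂ =>
        have h₁ : ∀ y : A q ⊗[ℂ] A p, LinearMap.mul' ℂ (A q)
            (TensorProduct.map (LinearMap.mul' ℂ (A q)) f'
              (TensorProduct.tensorTensorTensorComm ℂ _ _ _ _ ((x₁ ⊗ₜ x₂) ⊗ₜ[ℂ] y))) =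
            x₁ * LinearMap.mul' ℂ (A q) (TensorProduct.map LinearMap.id S y) * S x₂ := by
          intro y
          induction y with
          | zero => simp
          | add y y' hy hy' =>
            simp only [TensorProduct.tmul_add, map_add, hy, hy', mul_add, add_mul]
          | tmul y₁ y₂ => simp [f', mul_assoc]
        have h₂ : LinearMap.mul' ℂ (A q) (TensorProduct.map LinearMap.id S
            (H.comulOf hqp b)) = H.counit b • (1 : A q) :=
          LinearMap.congr_fun (hH.conv_id_antipodeOf hqp hpq) b
        rw [h₁, h₂]
        simp
    ext a b
    refine (key (H.comulOf hqp a) b).trans ?_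
    have h₂ : LinearMap.mul' ℂ (A q) (TensorProduct.map LinearMap.id S
        (H.comulOf hqp a)) = H.counit a • (1 : A q) :=
      LinearMap.congr_fun (hH.conv_id_antipodeOf hqp hpq) a
    rw [h₂, smul_smul, mul_comm]
    simp [GroupCoalgebra.convOne, GroupCoalgebra.tensorSquare, toGroupCoalgebra, K,
      GroupCoalgebra.tensorSquareCounit]
  have h := K.tensorSquare.eq_of_conv_eq_convOne hpq hqp hl hr
  simpa [f, f', S] using LinearMap.congr_fun h (a ⊗ₜ b)

/-- The antipode as a homomorphism to the opposite algebra. -/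
noncomputable def antipodeHom {p q : G} (hpq : p * q = 1) (hqp : q * p = 1) :
    A p →ₐ[ℂ] (A q)ᵐᵒᵖ :=
  AlgHom.ofLinearMap ((MulOpposite.opLinearEquiv ℂ).toLinearMap ∘ₗ H.antipodeOf hpq)
    (by simp [hH.antipodeOf_one hpq])
    (by simp [hH.antipodeOf_mul hpq hqp])

theorem antipodeHom_apply {p q : G} (hpq : p * q = 1) (hqp : q * p = 1) (a : A p) :
    hH.antipodeHom hpq hqp a = MulOpposite.op (H.antipodeOf hpq a) := rfl

/-! ### Compatibility of the antipode and its square with counit and comultiplication -/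

theorem counit_antipodeOf (h : (1 : G) * 1 = 1) (a : A 1) :
    H.counit (H.antipodeOf h a) = H.counit a := by
  let K := hH.toGroupCoalgebra
  have h₁ : K.convOne ℂ = H.counit.toLinearMap := by
    ext a
    simp [K, GroupCoalgebra.convOne, toGroupCoalgebra]
  have h₂ := congrArg (H.counit.toLinearMap ∘ₗ ·) (hH.conv_antipodeOf_id h)
  simp only [GroupCoalgebra.comp_conv, GroupCoalgebra.comp_convOne, LinearMap.comp_id] at h₂
  change K.conv h _ _ = K.convOne ℂ at h₂
  -- The counit is itself the convolution unit for target `ℂ`, so `(ε ∘ S) * ε = ε` reads `ε ∘ S =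
  -- ε`.
  rw [← h₁, K.conv_convOne] at h₂
  simpa [h₁] using LinearMap.congr_fun h₂ a

/-- Both sides are convolution inverses of `Δ` on `A 1`. Since `Δ = i * j` for the two inclusions,
`(j S) * (i S)` is a right inverse. -/
theorem comulOf_antipodeOf {p q : G} (hpq : p * q = 1) (hqp : q * p = 1)
    (h : (1 : G) * 1 = 1) (a : A 1) :
    H.comulOf hpq (H.antipodeOf h a) =
      TensorProduct.map (H.antipodeOf hqp) (H.antipodeOf hpq)
        (TensorProduct.comm ℂ (A p) (A q) (H.comulOf hpq a)) := by
  let K := hH.toGroupCoalgebra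
  let i : A p →ₐ[ℂ] A p ⊗[ℂ] A q := Algebra.TensorProduct.includeLeft
  let j : A q →ₐ[ℂ] A p ⊗[ℂ] A q := Algebra.TensorProduct.includeRight
  let iS := i.toLinearMap ∘ₗ H.antipodeOf hqp
  let jS := j.toLinearMap ∘ₗ H.antipodeOf hpq
  have hij : K.conv hpq i.toLinearMap j.toLinearMap = (H.comulOf hpq).toLinearMap := by
    have h₁ : LinearMap.mul' ℂ (A p ⊗[ℂ] A q) ∘ₗ
        TensorProduct.map i.toLinearMap j.toLinearMap = LinearMap.id := by
      ext x y
      simp [i, j]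
    ext a
    exact LinearMap.congr_fun h₁ (H.comulOf hpq a)
  have hji : K.conv hpq jS iS =
      TensorProduct.map (H.antipodeOf hqp) (H.antipodeOf hpq) ∘ₗ
        (TensorProduct.comm ℂ (A p) (A q)).toLinearMap ∘ₗ (H.comulOf hpq).toLinearMap := by
    have h₁ : LinearMap.mul' ℂ (A p ⊗[ℂ] A q) ∘ₗ TensorProduct.map jS iS =
        TensorProduct.map (H.antipodeOf hqp) (H.antipodeOf hpq) ∘ₗ
          (TensorProduct.comm ℂ (A p) (A q)).toLinearMap := by
      ext x y
      simp [i, j, iS, jS]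
    ext a
    exact LinearMap.congr_fun h₁ (H.comulOf hpq a)
  have hl : K.conv h ((H.comulOf hpq).toLinearMap ∘ₗ H.antipodeOf h)
      (H.comulOf hpq).toLinearMap = K.convOne (A p ⊗[ℂ] A q) := by
    have h₁ := K.comp_conv h (H.comulOf hpq) (H.antipodeOf h) LinearMap.id
    rw [LinearMap.comp_id] at h₁
    rw [← h₁, hH.conv_antipodeOf_id, K.comp_convOne]
  have hj : K.conv hqp j.toLinearMap jS = K.convOne (A p ⊗[ℂ] A q) := by
    have h₁ := K.comp_conv hqp j LinearMap.id (H.antipodeOf hpq)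
    rw [LinearMap.comp_id] at h₁
    rw [← h₁, hH.conv_id_antipodeOf, K.comp_convOne]
  have hi : K.conv hpq i.toLinearMap iS = K.convOne (A p ⊗[ℂ] A q) := by
    have h₁ := K.comp_conv hpq i LinearMap.id (H.antipodeOf hqp)
    rw [LinearMap.comp_id] at h₁
    rw [← h₁, hH.conv_id_antipodeOf, K.comp_convOne]
  have hr : K.conv h (H.comulOf hpq).toLinearMap (K.conv hpq jS iS) =
      K.convOne (A p ⊗[ℂ] A q) := by
    rw [← hij, K.conv_assoc hpq h (mul_one q) hpq,
      ← K.conv_assoc hqp (one_mul q) hpq (mul_one q), hj, K.convOne_conv, hi]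
  have := K.eq_of_conv_eq_convOne h h hl hr
  rw [hji] at this
  exact LinearMap.congr_fun this a

/-- The square of the antipode on `A_p`. -/
noncomputable def antipodeSq {p q : G} (hpq : p * q = 1) (hqp : q * p = 1) :
    A p →ₐ[ℂ] A p :=
  AlgHom.ofLinearMap (H.antipodeOf hqp ∘ₗ H.antipodeOf hpq)
    (by simp [hH.antipodeOf_one])
    (by simp [hH.antipodeOf_mul hpq hqp, hH.antipodeOf_mul hqp hpq])

theorem antipodeSq_apply {p q : G} (hpq : p * q = 1) (hqp : q * p = 1) (a : A p) :
    hH.antipodeSq hpq hqp a = H.antipodeOf hqp (H.antipodeOf hpq a) := rfl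

theorem comulOf_antipodeSq_pow {p q : G} (hpq : p * q = 1) (hqp : q * p = 1)
    (h : (1 : G) * 1 = 1) (N : ℕ) :
    (H.comulOf hpq).toLinearMap ∘ₗ ((hH.antipodeSq h h).toLinearMap ^ N) =
      TensorProduct.map ((hH.antipodeSq hpq hqp).toLinearMap ^ N)
        ((hH.antipodeSq hqp hpq).toLinearMap ^ N) ∘ₗ (H.comulOf hpq).toLinearMap := by
  have h₁ : (H.comulOf hpq).toLinearMap ∘ₗ (hH.antipodeSq h h).toLinearMap =
      TensorProduct.map (hH.antipodeSq hpq hqp).toLinearMap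
        (hH.antipodeSq hqp hpq).toLinearMap ∘ₗ (H.comulOf hpq).toLinearMap := by
    ext a
    simp only [LinearMap.comp_apply, AlgHom.toLinearMap_apply, antipodeSq_apply]
    rw [hH.comulOf_antipodeOf hpq hqp, hH.comulOf_antipodeOf hpq hqp]
    generalize H.comulOf hpq a = x
    induction x with
    | zero => simp
    | add x y hx hy => simp only [map_add, hx, hy]
    | tmul x y => simp [antipodeSq_apply]
  induction N with
  | zero => ext a; simp
  | succ N ih =>
    rw [pow_succ, Module.End.mul_eq_comp, ← LinearMap.comp_assoc, ih, LinearMap.comp_assoc, h₁,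
      ← LinearMap.comp_assoc, ← TensorProduct.map_comp, ← Module.End.mul_eq_comp,
      ← Module.End.mul_eq_comp, ← pow_succ, ← pow_succ]

theorem counit_antipodeSq_pow (h : (1 : G) * 1 = 1) (N : ℕ) :
    H.counit.toLinearMap ∘ₗ ((hH.antipodeSq h h).toLinearMap ^ N) =
      H.counit.toLinearMap := by
  induction N with
  | zero => ext a; simp
  | succ N ih =>
    rw [pow_succ, Module.End.mul_eq_comp, ← LinearMap.comp_assoc, ih]
    ext a
    simp [antipodeSq_apply, hH.counit_antipodeOf]

/-! ### Bijectivity of the antipode -/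

/-- If the linear endomorphisms `P` are compatible with comultiplication and counit, then an algebra
homomorphism `φ` on `A_p` is fixed by `P_p` as soon as `φ ∘ S_q` is fixed by `P_q`. -/
theorem comp_eq_of_comp_antipodeOf_comp_eq {p q : G} (hpq : p * q = 1) (hqp : q * p = 1)
    {P₁ : A 1 →ₗ[ℂ] A 1} {P : A p →ₗ[ℂ] A p} {Q : A q →ₗ[ℂ] A q}
    (hcomul : TensorProduct.map Q P ∘ₗ (H.comulOf hqp).toLinearMap =
      (H.comulOf hqp).toLinearMap ∘ₗ P₁)
    (hcounit : H.counit.toLinearMap ∘ₗ P₁ = H.counit.toLinearMap)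
    {D : Type*} [Ring D] [Algebra ℂ D] (φ : A p →ₐ[ℂ] D)
    (hφ : φ.toLinearMap ∘ₗ H.antipodeOf hqp ∘ₗ Q = φ.toLinearMap ∘ₗ H.antipodeOf hqp) :
    φ.toLinearMap ∘ₗ P = φ.toLinearMap := by
  let K := hH.toGroupCoalgebra
  have hl : K.conv hpq φ.toLinearMap (φ.toLinearMap ∘ₗ H.antipodeOf hqp) = K.convOne D := by
    have h₁ := K.comp_conv hpq φ LinearMap.id (H.antipodeOf hqp)
    rw [LinearMap.comp_id] at h₁
    rw [← h₁, hH.conv_id_antipodeOf, K.comp_convOne]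
  have hr : K.conv hqp (φ.toLinearMap ∘ₗ H.antipodeOf hqp) φ.toLinearMap = K.convOne D := by
    have h₁ := K.comp_conv hqp φ (H.antipodeOf hqp) LinearMap.id
    rw [LinearMap.comp_id] at h₁
    rw [← h₁, hH.conv_antipodeOf_id, K.comp_convOne]
  -- By `hφ` the first factor may be precomposed with `Q`; `hcomul` then moves both projections to a
  -- single `P₁`, which `ε` absorbs.
  have hP : K.conv hqp (φ.toLinearMap ∘ₗ H.antipodeOf hqp) (φ.toLinearMap ∘ₗ P) =
      K.convOne D := by
    have h₁ : ∀ g : A q →ₗ[ℂ] D, K.conv hqp (g ∘ₗ Q) (φ.toLinearMap ∘ₗ P) =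
        K.conv hqp g φ.toLinearMap ∘ₗ P₁ := by
      intro g
      ext a
      have h₂ := LinearMap.congr_fun hcomul a
      simp only [GroupCoalgebra.conv, TensorProduct.map_comp, LinearMap.comp_apply]
      exact congrArg (fun x => LinearMap.mul' ℂ D (TensorProduct.map g φ.toLinearMap x)) h₂
    rw [← hφ, ← LinearMap.comp_assoc, h₁, hr]
    ext a
    have h₂ : H.counit (P₁ a) = H.counit a := LinearMap.congr_fun hcounit a
    simp [GroupCoalgebra.convOne, K, toGroupCoalgebra, h₂]
  exact (K.eq_of_conv_eq_convOne hpq hqp hl hP).symm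

theorem bijective_antipodeSq {p q : G} [FiniteDimensional ℂ (A p)] [FiniteDimensional ℂ (A q)]
    [FiniteDimensional ℂ (A 1)] (hpq : p * q = 1) (hqp : q * p = 1) :
    Function.Bijective (hH.antipodeSq hpq hqp) := by
  have h : (1 : G) * 1 = 1 := one_mul 1
  set T := (hH.antipodeSq hpq hqp).toLinearMap
  set T' := (hH.antipodeSq hqp hpq).toLinearMap
  set T₁ := (hH.antipodeSq h h).toLinearMap
  obtain ⟨k, hk⟩ := Module.End.exists_forall_pow_mul_mul_pow_eq T
  obtain ⟨k', hk'⟩ := Module.End.exists_forall_pow_mul_mul_pow_eq T'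
  obtain ⟨k₁, hk₁⟩ := Module.End.exists_forall_pow_mul_mul_pow_eq T₁
  -- One exponent serves all three spaces; the `+ 1` lets a factor `T` be split off `T ^ N` even
  -- when the bounds vanish.
  let N := k + k' + k₁ + 1
  obtain ⟨U, hTU, hU⟩ := hk N (by omega)
  obtain ⟨U', hTU', hU'⟩ := hk' N (by omega)
  obtain ⟨U₁, hTU₁, hU₁⟩ := hk₁ N (by omega)
  have hcomul : TensorProduct.map (T ^ N * U) (T' ^ N * U') ∘ₗ (H.comulOf hpq).toLinearMap =
      (H.comulOf hpq).toLinearMap ∘ₗ (T₁ ^ N * U₁) :=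
    map_comp_eq_comp_of_mul_mul_eq (hH.comulOf_antipodeSq_pow hpq hqp h N)
      (hTU.pow_left N).eq (hTU'.pow_left N).eq hU hU' (hTU₁.pow_left N).eq hU₁
  have hcomul' : TensorProduct.map (T' ^ N * U') (T ^ N * U) ∘ₗ (H.comulOf hqp).toLinearMap =
      (H.comulOf hqp).toLinearMap ∘ₗ (T₁ ^ N * U₁) :=
    map_comp_eq_comp_of_mul_mul_eq (hH.comulOf_antipodeSq_pow hqp hpq h N)
      (hTU'.pow_left N).eq (hTU.pow_left N).eq hU' hU (hTU₁.pow_left N).eq hU₁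
  have hcounit : H.counit.toLinearMap ∘ₗ (T₁ ^ N * U₁) = H.counit.toLinearMap := by
    have h₁ := hH.counit_antipodeSq_pow h N
    calc H.counit.toLinearMap ∘ₗ (T₁ ^ N * U₁)
        = (H.counit.toLinearMap ∘ₗ T₁ ^ N) ∘ₗ (T₁ ^ N * U₁) := by rw [h₁]
      _ = H.counit.toLinearMap ∘ₗ (T₁ ^ N * U₁ * T₁ ^ N) := by
        rw [mul_assoc, ← (hTU₁.pow_left N).eq]; rfl
      _ = H.counit.toLinearMap := by rw [hU₁, h₁]
  have descent : ∀ (n : ℕ) (φ : A p →ₐ[ℂ] A p),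
      φ.toLinearMap ∘ₗ (T ^ n * (T ^ N * U)) = φ.toLinearMap ∘ₗ (T ^ n) →
      φ.toLinearMap ∘ₗ (T ^ N * U) = φ.toLinearMap := by
    intro n
    induction n with
    | zero => intro φ hφ; rwa [pow_zero, one_mul] at hφ
    | succ n ih =>
      intro φ hφ
      -- The hypothesis for `φ ∘ T` leaves one `S²` to cancel, in two steps: first for `φ ∘ S`, a
      -- homomorphism into the opposite algebra, then for `φ`.
      have h₁ := ih (φ.comp (hH.antipodeSq hpq hqp)) (by rw [pow_succ'] at hφ; exact hφ)
      refine hH.comp_eq_of_comp_antipodeOf_comp_eq hpq hqp hcomul' hcounit φ ?_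
      have h₂ := hH.comp_eq_of_comp_antipodeOf_comp_eq hqp hpq hcomul hcounit
        (φ.op.comp (hH.antipodeHom hqp hpq)) (by
          ext a
          exact congrArg MulOpposite.op (LinearMap.congr_fun h₁ a))
      ext a
      exact MulOpposite.op_injective (LinearMap.congr_fun h₂ a)
  have hid : T ^ N * U = 1 := by
    refine descent N (AlgHom.id ℂ (A p)) ?_
    rw [(hTU.pow_left N).eq, ← mul_assoc, hU]
  have hid' : U * T ^ N = 1 := by rw [← (hTU.pow_left N).eq, hid]
  constructor
  · intro a b hab
    have h₁ : T a = T b := hab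
    have h₂ : ∀ a, (U * T ^ (k + k' + k₁)) (T a) = a := fun a => by
      rw [← Module.End.mul_apply, mul_assoc, ← pow_succ, hid', Module.End.one_apply]
    rw [← h₂ a, h₁, h₂ b]
  · intro a
    refine ⟨(T ^ (k + k' + k₁) * U) a, ?_⟩
    change T ((T ^ (k + k' + k₁) * U) a) = a
    rw [← Module.End.mul_apply, ← mul_assoc, ← pow_succ', hid, Module.End.one_apply]

theorem bijective_antipode [∀ p, FiniteDimensional ℂ (A p)] (p : G) :
    Function.Bijective (H.antipode p) := by
  have hpq := mul_inv_cancel p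
  have hqp := inv_mul_cancel p
  have h₁ := hH.bijective_antipodeSq hpq hqp
  have h₂ := hH.bijective_antipodeSq hqp hpq
  exact ⟨Function.Injective.of_comp (f := H.antipodeOf hqp) h₁.1,
    Function.Surjective.of_comp (g := H.antipodeOf hqp) h₂.2⟩

theorem isAlgAntiIso_antipode [∀ p, FiniteDimensional ℂ (A p)] (p : G) :
    IsAlgAntiIso (H.antipode p) :=
  ⟨AlgEquiv.ofBijective (hH.antipodeHom (mul_inv_cancel p) (inv_mul_cancel p))
    (MulOpposite.op_bijective.comp (hH.bijective_antipode p)), fun _ => rfl⟩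

end IsVirelizier
end HopfGroupData

theorem lemma3p2 {G : Type u} [Group G] {A : G → Type v}
    [∀ p, Ring (A p)] [∀ p, Algebra ℂ (A p)] [∀ p, FiniteDimensional ℂ (A p)]
    (H : HopfGroupData G A) :
    (H.IsVirelizier → ∀ p : G, IsAlgAntiIso (H.antipode p)) ∧
      (H.IsVirelizier ↔ H.IsTuraev) :=
  ⟨fun hH => hH.isAlgAntiIso_antipode,
    fun hH => ⟨hH.coassociative, hH.counital, hH.antipodal, hH.isAlgAntiIso_antipode⟩,
    fun hH => ⟨hH.coassociative, hH.counital, hH.antipodal⟩⟩
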